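/- Let $d\ge 1$, let $\Omega\subset\mathbb{R}^d$ be a bounded open set with Lipschitz boundary, and let $\Gamma_0\subset\partial\Omega$ have non-zero $(d-1)$-dimensional measure. Let $p\in(1,\infty)$, $r=\frac{2p}{p+1}\in(1,2)$ and $r'=\frac{r}{r-1}=\frac{2p}{p-1}$. Let $E_s^2$ be the space of symmetric $d\times d$ tensors with $\sigma\cdot\varepsilon=\sum_{i,j}\sigma_{ij}\varepsilon_{ij}$ and $\|\sigma\|=\sqrt{\sigma\cdot\sigma}$; for $\sigma\in E_s^2$ put $\operatorname{tr}\sigma=\sum_i\sigma_{ii}$, $\operatorname{Tr}\sigma=\frac{1}{\sqrt d}\operatorname{tr}\sigma$ and $\operatorname{dev}\sigma=\sigma-\frac1d(\operatorname{tr}\sigma)I$. For $v\in W^{1,r'}(\Omega;\mathbb{R}^d)$ let $\varepsilon(v)=\frac12(\nabla v+(\nabla v)^\top)$, and let $V^{r'}(\Omega)$ be the set of $v\in W^{1,r'}(\Omega;\mathbb{R}^d)$ whose trace vanishes almost everywhere on $\Gamma_0$ with respect to the $(d-1)$-dimensional measure. Let $f$ be an element of the dual of $W^{1,r'}(\Omega;\mathbb{R}^d)$,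 and let $$\Sigma_f(\Omega)=\Big\{\tau\in L^r(\Omega;E_s^2)\ :\ \int_\Omega\tau\cdot\varepsilon(v)\,dx=f(v)\ \text{ for all } v\in V^{r'}(\Omega)\Big\}.$$ For non-negative $k,\mu\in L^p(\Omega)$ define the compliance $$\mathcal{C}(k,\mu)=\inf_{\tau\in\Sigma_f(\Omega)}\int_\Omega\Big(\frac{(\operatorname{Tr}\tau)^2}{dk}+\frac{\|\operatorname{dev}\tau\|^2}{2\mu}\Big)dx\in[0,+\infty],$$ where $\frac00:=0$ and $\frac a0:=+\infty$ for $a>0$. Then the functional $\mathcal{C}:(L^p(\Omega;\mathbb{R}_+))^2\to[0,+\infty]$ is convex and lower semicontinuous with respect to the weak topology of $(L^p(\Omega))^2$. -/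

import Mathlib

open MeasureTheory Set Filter Topology
open scoped ENNReal NNReal ContDiff

noncomputable section

namespace Elasticity

/-! ### Vectors and tensors -/

/-- The Euclidean space `ℝ^d`. -/
abbrev Vec (d : ℕ) : Type := EuclideanSpace ℝ (Fin d)

/-- Second rank tensors, with the scalar product `σ · ε = ∑ i j, σ_ij ε_ij`. -/
abbrev Tensor (d : ℕ) : Type := EuclideanSpace ℝ (Fin d × Fin d)

/-- The tensor `σ` is symmetric, i.e. it belongs to `E_s²`. -/
def IsSymmetric {d : ℕ} (σ : Tensor d) : Prop := ∀ i j, σ (i, j) = σ (j, i)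

/-- The symmetric part `(A + Aᵀ) / 2`. -/
def symPart {d : ℕ} (A : Tensor d) : Tensor d :=
  WithLp.toLp 2 fun ij => (A (ij.1, ij.2) + A (ij.2, ij.1)) / 2

/-- The identity tensor. -/
def idTensor (d : ℕ) : Tensor d := WithLp.toLp 2 fun ij => if ij.1 = ij.2 then 1 else 0

/-- The usual trace `tr σ = ∑ i, σ_ii`. -/
def tr {d : ℕ} (σ : Tensor d) : ℝ := ∑ i, σ (i, i)

/-- The normalised trace `Tr σ = tr σ / √d`. -/
def nTr {d : ℕ} (σ : Tensor d) : ℝ := tr σ / Real.sqrt d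

/-- The deviator: `σ = (1/d) (tr σ) I + dev σ`. -/
def dev {d : ℕ} (σ : Tensor d) : Tensor d := σ - (tr σ / d) • idTensor d

/-! ### Lipschitz boundary -/

/-- The open set `Ω` has a Lipschitz boundary: near each boundary point, in suitable orthonormal
coordinates (with last axis along the unit vector `ν`), `Ω` is the part of the space strictly below
the graph of a Lipschitz function of the component orthogonal to `ν`. -/
def HasLipschitzBoundary {d : ℕ} (Ω : Set (Vec d)) : Prop :=
  ∀ x ∈ frontier Ω, ∃ ν : Vec d, ‖ν‖ = 1 ∧ ∃ (γ : Vec d → ℝ) (K : ℝ≥0), LipschitzWith K γ ∧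
    ∃ U ∈ 𝓝 x, ∀ y ∈ U, (y ∈ Ω ↔ inner ℝ ν y < γ (y - (inner ℝ ν y) • ν))

/-- The `(d-1)`-dimensional surface measure on `∂Ω`. -/
def surfaceMeasure {d : ℕ} (Ω : Set (Vec d)) : Measure (Vec d) :=
  (Measure.hausdorffMeasure ((d : ℝ) - 1)).restrict (frontier Ω)

/-! ### Sobolev spaces -/

/-- `G` is the weak gradient of `u` in `Ω`: `G_ij = ∂_j u_i` in the sense of distributions. -/
def IsWeakGradient {d : ℕ} (Ω : Set (Vec d)) (u : Vec d → Vec d) (G : Vec d → Tensor d) : Prop :=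
  ∀ φ : Vec d → ℝ, ContDiff ℝ ∞ φ → HasCompactSupport φ → tsupport φ ⊆ Ω → ∀ i j : Fin d,
    ∫ x in Ω, u x i * fderiv ℝ φ x (EuclideanSpace.single j 1) = - ∫ x in Ω, G x (i, j) * φ x

lemma integrable_coord_mul {d : ℕ} {Ω : Set (Vec d)} {ι : Type} [Fintype ι] {s : ℝ≥0∞}
    (hs : 1 ≤ s) (u : Lp (EuclideanSpace ℝ ι) s (volume.restrict Ω)) (i : ι) {ψ : Vec d → ℝ}
    (hψ : Continuous ψ) (hc : HasCompactSupport ψ) :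
    Integrable (fun x => u x i * ψ x) (volume.restrict Ω) := by
  have h1 : MemLp (fun x => u x i) s (volume.restrict Ω) :=
    ContinuousLinearMap.comp_memLp' (EuclideanSpace.proj i : EuclideanSpace ℝ ι →L[ℝ] ℝ) (Lp.memLp u)
  have h2 := (h1.locallyIntegrable hs).integrable_smul_right_of_hasCompactSupport hψ hc
  simpa [smul_eq_mul] using h2

/-- The Sobolev space `W^{1,s}(Ω; ℝ^d)`: pairs `(u, ∇u)` of a function in `L^s(Ω; ℝ^d)` and its weak
gradient in `L^s(Ω; ℝ^{d×d})`. The norm is `max (‖u‖_s) (‖∇u‖_s)`, which is equivalent to the other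
usual choices. -/
def Sobolev {d : ℕ} (Ω : Set (Vec d)) (s : ℝ≥0∞) [hs : Fact (1 ≤ s)] :
    Submodule ℝ (Lp (Vec d) s (volume.restrict Ω) × Lp (Tensor d) s (volume.restrict Ω)) where
  carrier := {w | IsWeakGradient Ω w.1 w.2}
  add_mem' := by
    intro a b ha hb φ h1 h2 h3 i j
    have hd : Continuous fun x => fderiv ℝ φ x (EuclideanSpace.single j 1) :=
      (h1.continuous_fderiv (by simp)).clm_apply continuous_const
    have hdc : HasCompactSupport fun x => fderiv ℝ φ x (EuclideanSpace.single j 1) :=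
      h2.fderiv_apply ℝ _
    have e1 : ∫ x in Ω, (a + b).1 x i * fderiv ℝ φ x (EuclideanSpace.single j 1)
        = ∫ x in Ω, (a.1 x i * fderiv ℝ φ x (EuclideanSpace.single j 1)
          + b.1 x i * fderiv ℝ φ x (EuclideanSpace.single j 1)) := by
      refine integral_congr_ae ?_
      filter_upwards [Lp.coeFn_add a.1 b.1] with x hx
      rw [Prod.fst_add, hx]
      simp [add_mul]
    have e2 : ∫ x in Ω, (a + b).2 x (i, j) * φ x
        = ∫ x in Ω, (a.2 x (i, j) * φ x + b.2 x (i, j) * φ x) := by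
      refine integral_congr_ae ?_
      filter_upwards [Lp.coeFn_add a.2 b.2] with x hx
      rw [Prod.snd_add, hx]
      simp [add_mul]
    rw [e1, e2, integral_add (integrable_coord_mul hs.out a.1 i hd hdc)
      (integrable_coord_mul hs.out b.1 i hd hdc),
      integral_add (integrable_coord_mul hs.out a.2 (i, j) h1.continuous h2)
      (integrable_coord_mul hs.out b.2 (i, j) h1.continuous h2),
      ha φ h1 h2 h3 i j, hb φ h1 h2 h3 i j]
    ring
  zero_mem' := by
    intro φ h1 h2 h3 i j
    have e1 : ∫ x in Ω, (0 : Lp (Vec d) s (volume.restrict Ω)) x i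
        * fderiv ℝ φ x (EuclideanSpace.single j 1) = 0 := by
      refine integral_eq_zero_of_ae ?_
      filter_upwards [Lp.coeFn_zero (Vec d) s (volume.restrict Ω)] with x hx
      rw [hx]
      simp
    have e2 : ∫ x in Ω, (0 : Lp (Tensor d) s (volume.restrict Ω)) x (i, j) * φ x = 0 := by
      refine integral_eq_zero_of_ae ?_
      filter_upwards [Lp.coeFn_zero (Tensor d) s (volume.restrict Ω)] with x hx
      rw [hx]
      simp
    rw [Prod.fst_zero, Prod.snd_zero, e1, e2, neg_zero]
  smul_mem' := by
    intro c a ha φ h1 h2 h3 i j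
    have e1 : ∫ x in Ω, (c • a).1 x i * fderiv ℝ φ x (EuclideanSpace.single j 1)
        = ∫ x in Ω, c * (a.1 x i * fderiv ℝ φ x (EuclideanSpace.single j 1)) := by
      refine integral_congr_ae ?_
      filter_upwards [Lp.coeFn_smul c a.1] with x hx
      rw [Prod.smul_fst, hx]
      simp [mul_assoc]
    have e2 : ∫ x in Ω, (c • a).2 x (i, j) * φ x = ∫ x in Ω, c * (a.2 x (i, j) * φ x) := by
      refine integral_congr_ae ?_
      filter_upwards [Lp.coeFn_smul c a.2] with x hx
      rw [Prod.smul_snd, hx]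
      simp [mul_assoc]
    rw [e1, e2, integral_const_mul, integral_const_mul, ha φ h1 h2 h3 i j]
    ring

/-- The strain field `ε(v) = (∇v + (∇v)ᵀ) / 2`. -/
def strain {d : ℕ} {Ω : Set (Vec d)} {s : ℝ≥0∞} [Fact (1 ≤ s)] (v : Sobolev Ω s) (x : Vec d) :
    Tensor d :=
  symPart (v.1.2 x)

/-- The classical gradient `(∂_j φ_i)_ij` of a differentiable vector field. -/
def classicalGradient {d : ℕ} (φ : Vec d → Vec d) (x : Vec d) : Tensor d :=
  WithLp.toLp 2 fun ij => fderiv ℝ φ x (EuclideanSpace.single ij.2 1) ij.1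

/-- `g ∈ L^s(∂Ω; ℝ^d)` is the trace on `∂Ω` of `v ∈ W^{1,s}(Ω; ℝ^d)`. The trace operator is the
continuous extension of the restriction `φ ↦ φ|_∂Ω` of functions `φ` smooth up to the boundary. -/
def IsTrace {d : ℕ} {Ω : Set (Vec d)} {s : ℝ≥0∞} [Fact (1 ≤ s)] (v : Sobolev Ω s)
    (g : Vec d → Vec d) : Prop :=
  MemLp g s (surfaceMeasure Ω) ∧ ∃ φ : ℕ → Vec d → Vec d, (∀ n, ContDiff ℝ ∞ (φ n)) ∧
    Tendsto (fun n => eLpNorm (fun x => φ n x - v.1.1 x) s (volume.restrict Ω)) atTop (𝓝 0) ∧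
    Tendsto (fun n => eLpNorm (fun x => classicalGradient (φ n) x - v.1.2 x) s
      (volume.restrict Ω)) atTop (𝓝 0) ∧
    Tendsto (fun n => eLpNorm (fun x => φ n x - g x) s (surfaceMeasure Ω)) atTop (𝓝 0)

/-- The virtual displacements: those `v ∈ W^{1,s}(Ω; ℝ^d)` with `v = 0` a.e. on `Γ₀` with respect to
the surface measure, in the sense of traces. -/
def virtualDisplacements {d : ℕ} (Ω Γ₀ : Set (Vec d)) (s : ℝ≥0∞) [Fact (1 ≤ s)] :
    Set (Sobolev Ω s) :=
  {v | ∃ g, IsTrace v g ∧ ∀ᵐ x ∂(surfaceMeasure Ω), x ∈ Γ₀ → g x = 0}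

/-! ### Exponents -/

/-- The exponent `p` of the space of moduli. -/
def expP (p : ℝ) : ℝ≥0∞ := ENNReal.ofReal p

/-- The exponent `r = 2p/(p+1)` of the space of stresses. -/
def expR (p : ℝ) : ℝ≥0∞ := ENNReal.ofReal (2 * p / (p + 1))

/-- The conjugate exponent `r' = 2p/(p-1)` of the space of displacements. -/
def expR' (p : ℝ) : ℝ≥0∞ := ENNReal.ofReal (2 * p / (p - 1))

instance expP_fact (p : ℝ) [hp : Fact (1 < p)] : Fact (1 ≤ expP p) :=
  ⟨ENNReal.one_le_ofReal.2 hp.out.le⟩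

instance expR_fact (p : ℝ) [hp : Fact (1 < p)] : Fact (1 ≤ expR p) :=
  ⟨ENNReal.one_le_ofReal.2 (by
    have := hp.out
    rw [le_div_iff₀ (by linarith)]
    linarith)⟩

instance expR'_fact (p : ℝ) [hp : Fact (1 < p)] : Fact (1 ≤ expR' p) :=
  ⟨ENNReal.one_le_ofReal.2 (by
    have := hp.out
    rw [le_div_iff₀ (by linarith)]
    linarith)⟩

/-! ### Statically admissible stresses and compliance -/

/-- A load: an element of the dual of `W^{1,r'}(Ω; ℝ^d)`. -/
abbrev Load {d : ℕ} (Ω : Set (Vec d)) (p : ℝ) [Fact (1 < p)] : Type :=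
  StrongDual ℝ (Sobolev Ω (expR' p))

/-- The set `Σ_f(Ω)` of statically admissible stresses: the a.e. symmetric tensor fields
`τ ∈ L^r(Ω)` with `∫_Ω τ · ε(v) dx = f(v)` for all virtual displacements `v`. -/
def admissibleStresses {d : ℕ} (Ω Γ₀ : Set (Vec d)) (p : ℝ) [Fact (1 < p)] (f : Load Ω p) :
    Set (Lp (Tensor d) (expR p) (volume.restrict Ω)) :=
  {τ | (∀ᵐ x ∂(volume.restrict Ω), IsSymmetric (τ x)) ∧
    ∀ v ∈ virtualDisplacements Ω Γ₀ (expR' p), ∫ x in Ω, inner ℝ (τ x) (strain v x) = f v}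

/-- The complementary energy `∫_Ω ((Tr τ)² / (dk) + ‖dev τ‖² / (2μ)) dx ∈ [0, ∞]`. The quotients are
taken in `[0, ∞]`, where `0 / 0 = 0` and `a / 0 = ∞` for `a > 0`. -/
def stressEnergy {d : ℕ} (Ω : Set (Vec d)) (k μ : Vec d → ℝ) (τ : Vec d → Tensor d) : ℝ≥0∞ :=
  ∫⁻ x in Ω, (ENNReal.ofReal (nTr (τ x) ^ 2) / ENNReal.ofReal (d * k x)
    + ENNReal.ofReal (‖dev (τ x)‖ ^ 2) / ENNReal.ofReal (2 * μ x))

/-- The space `(L^p(Ω))²` of pairs `(k, μ)`. -/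
abbrev Moduli {d : ℕ} (Ω : Set (Vec d)) (p : ℝ) : Type :=
  Lp ℝ (expP p) (volume.restrict Ω) × Lp ℝ (expP p) (volume.restrict Ω)

/-- The set `(L^p(Ω; ℝ₊))²` of pairs of (a.e.) non-negative moduli. -/
def nonnegModuli {d : ℕ} (Ω : Set (Vec d)) (p : ℝ) : Set (Moduli Ω p) :=
  {z | 0 ≤ z.1 ∧ 0 ≤ z.2}

/-- The compliance `C(k, μ)`, as an infimum over statically admissible stresses (`∞` if there are
none). -/
def compliance {d : ℕ} (Ω Γ₀ : Set (Vec d)) (p : ℝ) [Fact (1 < p)] (f : Load Ω p)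
    (z : Moduli Ω p) : ℝ≥0∞ :=
  ⨅ τ ∈ admissibleStresses Ω Γ₀ p f, stressEnergy Ω z.1 z.2 τ

end Elasticity

end

/-!
The compliance is convex because `(x, a) ↦ ‖x‖² / a`, extended to `a = 0` by the conventions of
`[0, ∞]`, is subadditive and positively homogeneous. Hence the stress energy is jointly convex in
the moduli and the stress, and since the set of admissible stresses does not depend on the moduli
and is stable under convex combinations, the partial infimum over it is convex
(`convexOn_compliance`).

By convexity, weak lower semicontinuity follows once the sublevel sets are closed for the norm
topology. For this, a stress `τ` of finite energy is written as
`τ = √(d k) (tr ρ / d) I + √(2 μ) dev ρ` with `ρ` in the Hilbert space `L²`, such that `‖ρ‖²` is the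
energy of `τ`; conversely every such `ρ` gives a stress in `L^r` of energy at most `‖ρ‖²`
(`exists_inner_weightedField_eq`, `compliance_le_of_inner_weightedField_eq`). The equilibrium
condition on `τ` becomes `⟪ρ, w⟫ = f v`, where `w = √(d k) (tr ε(v) / d) I + √(2 μ) dev ε(v)` lies
in `L²` and depends continuously on `(k, μ)` for the norm of `L^p` (`continuous_weightedField`). So
when `(k, μ)` converges in norm with bounded compliance, the fields `ρ` of almost optimal stresses
have a weak limit in `L²` (`exists_weak_limit`), which still satisfies the equilibrium condition for
the limit moduli, and the norm does not increase in the limit. The only compactness needed is thus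
that of balls of a Hilbert space.
-/

noncomputable section

namespace Elasticity

/-! ### The spherical and deviatoric parts of a tensor -/

section TensorAlgebra

variable {d : ℕ}

/-- The action of the isotropic tensor with moduli `a` and `b` : `A ↦ a (tr A / d) I + b dev A`. -/
def isotropic (a b : ℝ) (A : Tensor d) : Tensor d := a • ((tr A / d) • idTensor d) + b • dev A

@[simp] lemma tr_add (A B : Tensor d) : tr (A + B) = tr A + tr B := by
  simp [tr, Finset.sum_add_distrib]

@[simp] lemma tr_sub (A B : Tensor d) : tr (A - B) = tr A - tr B := by
  simp [tr, Finset.sum_sub_distrib]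

@[simp] lemma tr_smul (c : ℝ) (A : Tensor d) : tr (c • A) = c * tr A := by
  simp [tr, Finset.mul_sum]

@[simp] lemma tr_idTensor : tr (idTensor d) = d := by
  simp [tr, idTensor]

@[simp] lemma tr_symPart (A : Tensor d) : tr (symPart A) = tr A := by
  simp [tr, symPart]

lemma tr_dev (hd : d ≠ 0) (A : Tensor d) : tr (dev A) = 0 := by
  have : (d : ℝ) ≠ 0 := by exact_mod_cast hd
  simp [dev, this]

lemma dev_smul_idTensor (hd : d ≠ 0) (c : ℝ) : dev (c • idTensor d) = 0 := by
  have : (d : ℝ) ≠ 0 := by exact_mod_cast hd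
  simp [dev, this]

lemma dev_add (A B : Tensor d) : dev (A + B) = dev A + dev B := by
  simp only [dev, tr_add, add_div, add_smul]
  abel

lemma dev_smul (c : ℝ) (A : Tensor d) : dev (c • A) = c • dev A := by
  simp only [dev, tr_smul, mul_div_assoc, mul_smul, smul_sub]

lemma dev_dev (hd : d ≠ 0) (A : Tensor d) : dev (dev A) = dev A := by
  conv_lhs => rw [dev, tr_dev hd]
  simp

lemma nTr_add (A B : Tensor d) : nTr (A + B) = nTr A + nTr B := by
  simp [nTr, add_div]

lemma nTr_smul (c : ℝ) (A : Tensor d) : nTr (c • A) = c * nTr A := by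
  simp [nTr, mul_div_assoc]

lemma inner_idTensor_left (A : Tensor d) : inner ℝ (idTensor d) A = tr A := by
  simp [PiLp.inner_apply, idTensor, tr, Fintype.sum_prod_type]

lemma inner_idTensor_right (A : Tensor d) : inner ℝ A (idTensor d) = tr A := by
  rw [real_inner_comm, inner_idTensor_left]

lemma isotropic_one_one (A : Tensor d) : isotropic 1 1 A = A := by
  simp [isotropic, dev]

lemma tr_isotropic (hd : d ≠ 0) (a b : ℝ) (A : Tensor d) : tr (isotropic a b A) = a * tr A := by
  have : (d : ℝ) ≠ 0 := by exact_mod_cast hd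
  simp [isotropic, tr_dev hd, this]

lemma nTr_isotropic (hd : d ≠ 0) (a b : ℝ) (A : Tensor d) :
    nTr (isotropic a b A) = a * nTr A := by
  rw [nTr, tr_isotropic hd, nTr, mul_div_assoc]

lemma dev_isotropic (hd : d ≠ 0) (a b : ℝ) (A : Tensor d) :
    dev (isotropic a b A) = b • dev A := by
  rw [isotropic, smul_smul, dev_add, dev_smul_idTensor hd, dev_smul, dev_dev hd, zero_add]

lemma isotropic_isotropic (hd : d ≠ 0) (a b a' b' : ℝ) (A : Tensor d) :
    isotropic a b (isotropic a' b' A) = isotropic (a * a') (b * b') A := by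
  conv_lhs => rw [isotropic, tr_isotropic hd, dev_isotropic hd]
  simp only [isotropic, mul_div_assoc, smul_smul, mul_assoc]

lemma isotropic_sub_isotropic (a b a' b' : ℝ) (A : Tensor d) :
    isotropic a b A - isotropic a' b' A = isotropic (a - a') (b - b') A := by
  simp only [isotropic, sub_smul]
  abel

lemma inner_isotropic_left (hd : d ≠ 0) (a b : ℝ) (A B : Tensor d) :
    inner ℝ (isotropic a b A) B = a * (nTr A * nTr B) + b * inner ℝ (dev A) (dev B) := by
  have h0 : (d : ℝ) ≠ 0 := by exact_mod_cast hd
  have h1 : inner ℝ (dev A) B = inner ℝ (dev A) (dev B) := by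
    conv_rhs => rw [dev.eq_def B]
    rw [inner_sub_right, inner_smul_right, inner_idTensor_right, tr_dev hd, mul_zero, sub_zero]
  have h2 : nTr A * nTr B = tr A / d * tr B := by
    rw [nTr, nTr, div_mul_div_comm, Real.mul_self_sqrt (Nat.cast_nonneg d), mul_div_right_comm]
  rw [isotropic, inner_add_left, real_inner_smul_left, real_inner_smul_left, real_inner_smul_left,
    inner_idTensor_left, h1, h2]

/-- Isotropic tensors act by self-adjoint maps. -/
lemma inner_isotropic_comm (hd : d ≠ 0) (a b : ℝ) (A B : Tensor d) :
    inner ℝ (isotropic a b A) B = inner ℝ A (isotropic a b B) := by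
  rw [real_inner_comm (isotropic a b B) A, inner_isotropic_left hd, inner_isotropic_left hd,
    real_inner_comm (dev A), mul_comm (nTr A)]

lemma norm_isotropic_sq (hd : d ≠ 0) (a b : ℝ) (A : Tensor d) :
    ‖isotropic a b A‖ ^ 2 = a ^ 2 * nTr A ^ 2 + b ^ 2 * ‖dev A‖ ^ 2 := by
  rw [← real_inner_self_eq_norm_sq, inner_isotropic_left hd, nTr_isotropic hd, dev_isotropic hd,
    real_inner_smul_right, real_inner_self_eq_norm_sq]
  ring

/-- The spherical and the deviatoric part of a tensor are orthogonal. -/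
lemma norm_sq_eq_nTr_sq_add (hd : d ≠ 0) (A : Tensor d) :
    ‖A‖ ^ 2 = nTr A ^ 2 + ‖dev A‖ ^ 2 := by
  have := norm_isotropic_sq hd 1 1 A
  simpa [isotropic_one_one] using this

lemma norm_isotropic_le (hd : d ≠ 0) (a b : ℝ) (A : Tensor d) :
    ‖isotropic a b A‖ ≤ (|a| + |b|) * ‖A‖ := by
  refine (sq_le_sq₀ (norm_nonneg _) (by positivity)).1 ?_
  rw [norm_isotropic_sq hd, mul_pow, norm_sq_eq_nTr_sq_add hd A, mul_add]
  have ha : a ^ 2 ≤ (|a| + |b|) ^ 2 := by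
    rw [← sq_abs a]
    gcongr
    simp
  have hb : b ^ 2 ≤ (|a| + |b|) ^ 2 := by
    rw [← sq_abs b]
    gcongr
    simp
  gcongr

lemma isotropic_eq_self (hd : d ≠ 0) {a b : ℝ} {A : Tensor d} (ha : nTr A = 0 ∨ a = 1)
    (hb : dev A = 0 ∨ b = 1) : isotropic a b A = A := by
  have h0 : Real.sqrt d ≠ 0 := Real.sqrt_ne_zero'.2 (by exact_mod_cast Nat.pos_of_ne_zero hd)
  have e1 : a • ((tr A / d) • idTensor d) = (1 : ℝ) • ((tr A / d) • idTensor d) := by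
    rcases ha with h | rfl
    · have : tr A = 0 := by simpa [nTr, h0] using h
      simp [this]
    · rfl
  have e2 : b • dev A = (1 : ℝ) • dev A := by
    rcases hb with h | rfl
    · simp [h]
    · rfl
  rw [isotropic, e1, e2]
  exact isotropic_one_one A

lemma isSymmetric_symPart (A : Tensor d) : IsSymmetric (symPart A) := by
  intro i j
  simp [symPart, add_comm]

lemma symPart_eq_self {A : Tensor d} (hA : IsSymmetric A) : symPart A = A := by
  ext ⟨i, j⟩
  simp [symPart, hA j i]

lemma inner_symPart_comm (A B : Tensor d) : inner ℝ (symPart A) B = inner ℝ A (symPart B) := by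
  have h1 : ∑ i, ∑ j, B (i, j) * A (j, i) = ∑ i, ∑ j, B (j, i) * A (i, j) := Finset.sum_comm
  simp only [PiLp.inner_apply, symPart, Fintype.sum_prod_type, RCLike.inner_apply, conj_trivial,
    mul_div_assoc', div_mul_eq_mul_div, mul_add, add_mul, ← Finset.sum_div,
    Finset.sum_add_distrib, h1]

lemma symPart_symPart (A : Tensor d) : symPart (symPart A) = symPart A :=
  symPart_eq_self (isSymmetric_symPart A)

lemma norm_symPart_le (A : Tensor d) : ‖symPart A‖ ≤ ‖A‖ := by
  rcases eq_or_lt_of_le (norm_nonneg (symPart A)) with h | h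
  · rw [← h]
    exact norm_nonneg A
  · refine le_of_mul_le_mul_right ?_ h
    rw [← real_inner_self_eq_norm_mul_norm, inner_symPart_comm, symPart_symPart]
    exact real_inner_le_norm A (symPart A)

lemma symPart_sub (A B : Tensor d) : symPart (A - B) = symPart A - symPart B := by
  ext ij
  simp [symPart]
  ring

lemma symPart_smul_idTensor (c : ℝ) : symPart (c • idTensor d) = c • idTensor d := by
  refine symPart_eq_self fun i j => ?_
  simp [idTensor, eq_comm]

lemma dev_symPart (A : Tensor d) : dev (symPart A) = symPart (dev A) := by
  rw [dev, tr_symPart, dev, symPart_sub, symPart_smul_idTensor]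

lemma IsSymmetric.add {A B : Tensor d} (hA : IsSymmetric A) (hB : IsSymmetric B) :
    IsSymmetric (A + B) := fun i j => by simp [hA i j, hB i j]

lemma IsSymmetric.smul {A : Tensor d} (hA : IsSymmetric A) (c : ℝ) : IsSymmetric (c • A) :=
  fun i j => by simp [hA i j]

@[fun_prop]
lemma continuous_tr : Continuous (tr : Tensor d → ℝ) := by
  unfold tr
  fun_prop

@[fun_prop]
lemma continuous_nTr : Continuous (nTr : Tensor d → ℝ) := by
  unfold nTr
  fun_prop

@[fun_prop]
lemma continuous_dev : Continuous (dev : Tensor d → Tensor d) := by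
  unfold dev
  fun_prop

@[fun_prop]
lemma continuous_symPart : Continuous (symPart : Tensor d → Tensor d) := by
  unfold symPart
  fun_prop

lemma continuous_isotropic :
    Continuous fun q : (ℝ × ℝ) × Tensor d => isotropic q.1.1 q.1.2 q.2 := by
  unfold isotropic
  fun_prop

end TensorAlgebra

/-! ### The quotient `‖x‖² / a` in `[0, ∞]` -/

section Quotient

variable {E : Type*} [NormedAddCommGroup E]

/-- Subadditivity of `(x, a) ↦ ‖x‖² / a`, which is positively homogeneous of degree one. -/
lemma ofReal_norm_add_sq_div_le (x y : E) {a b : ℝ} (ha : 0 ≤ a) (hb : 0 ≤ b) :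
    ENNReal.ofReal (‖x + y‖ ^ 2) / ENNReal.ofReal (a + b) ≤
      ENNReal.ofReal (‖x‖ ^ 2) / ENNReal.ofReal a
        + ENNReal.ofReal (‖y‖ ^ 2) / ENNReal.ofReal b := by
  have zero_case : ∀ (u : E) (c : ℝ), c = 0 → u ≠ 0 →
      ENNReal.ofReal (‖u‖ ^ 2) / ENNReal.ofReal c = ⊤ := by
    rintro u c rfl hu
    rw [ENNReal.ofReal_zero]
    exact ENNReal.div_zero (by simpa [sq_nonpos_iff] using hu)
  rcases ha.eq_or_lt with rfl | ha'
  · by_cases hx : x = 0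
    · simp [hx]
    · rw [zero_case x 0 rfl hx, top_add]
      exact le_top
  rcases hb.eq_or_lt with rfl | hb'
  · by_cases hy : y = 0
    · simp [hy]
    · rw [zero_case y 0 rfl hy, add_top]
      exact le_top
  rw [← ENNReal.ofReal_div_of_pos ha', ← ENNReal.ofReal_div_of_pos hb',
    ← ENNReal.ofReal_div_of_pos (by positivity),
    ← ENNReal.ofReal_add (by positivity) (by positivity)]
  refine ENNReal.ofReal_le_ofReal ?_
  have h1 : ‖x + y‖ ^ 2 ≤ (‖x‖ + ‖y‖) ^ 2 := by
    gcongr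
    exact norm_add_le x y
  refine (div_le_div_of_nonneg_right h1 (by positivity)).trans ?_
  rw [div_add_div _ _ ha'.ne' hb'.ne', div_le_div_iff₀ (by positivity) (by positivity)]
  nlinarith [sq_nonneg (b * ‖x‖ - a * ‖y‖)]

/-- If the quotient is finite, it is the square of the norm of `x / √a`. -/
lemma ofReal_norm_sq_div_eq (x : E) {a : ℝ} (ha : 0 ≤ a)
    (h : ENNReal.ofReal (‖x‖ ^ 2) / ENNReal.ofReal a ≠ ⊤) :
    ENNReal.ofReal (‖x‖ ^ 2) / ENNReal.ofReal a =
      ENNReal.ofReal ((Real.sqrt a)⁻¹ ^ 2 * ‖x‖ ^ 2) ∧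
        (x = 0 ∨ Real.sqrt a * (Real.sqrt a)⁻¹ = 1) := by
  rcases ha.eq_or_lt with rfl | ha'
  · have hx : x = 0 := by
      by_contra hx
      refine h ?_
      rw [ENNReal.ofReal_zero]
      exact ENNReal.div_zero (by simpa [sq_nonpos_iff] using hx)
    simp [hx]
  · refine ⟨?_, Or.inr (mul_inv_cancel₀ (Real.sqrt_ne_zero'.2 ha'))⟩
    rw [← ENNReal.ofReal_div_of_pos ha', inv_pow, Real.sq_sqrt ha, div_eq_inv_mul]

variable [NormedSpace ℝ E]

lemma ofReal_norm_smul_sq_div (x : E) (a : ℝ) {c : ℝ} (hc : 0 < c) :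
    ENNReal.ofReal (‖c • x‖ ^ 2) / ENNReal.ofReal (c * a) =
      ENNReal.ofReal c * (ENNReal.ofReal (‖x‖ ^ 2) / ENNReal.ofReal a) := by
  have h0 : ENNReal.ofReal c ≠ 0 := by simpa using hc
  rw [norm_smul, mul_pow, Real.norm_eq_abs, sq_abs, sq, mul_assoc, ENNReal.ofReal_mul hc.le,
    ENNReal.ofReal_mul hc.le (q := a), ENNReal.mul_div_mul_left _ _ h0 ENNReal.ofReal_ne_top,
    ENNReal.ofReal_mul hc.le, mul_div_assoc]

lemma ofReal_norm_convexCombo_sq_div_le (x y : E) {a b s t : ℝ} (ha : 0 ≤ a) (hb : 0 ≤ b)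
    (hs : 0 < s) (ht : 0 < t) :
    ENNReal.ofReal (‖s • x + t • y‖ ^ 2) / ENNReal.ofReal (s * a + t * b) ≤
      ENNReal.ofReal s * (ENNReal.ofReal (‖x‖ ^ 2) / ENNReal.ofReal a)
        + ENNReal.ofReal t * (ENNReal.ofReal (‖y‖ ^ 2) / ENNReal.ofReal b) := by
  rw [← ofReal_norm_smul_sq_div x a hs, ← ofReal_norm_smul_sq_div y b ht]
  exact ofReal_norm_add_sq_div_le _ _ (by positivity) (by positivity)

lemma ofReal_norm_sqrt_smul_sq_div_le (x : E) {a : ℝ} (ha : 0 ≤ a) :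
    ENNReal.ofReal (‖Real.sqrt a • x‖ ^ 2) / ENNReal.ofReal a ≤ ENNReal.ofReal (‖x‖ ^ 2) := by
  rw [norm_smul, mul_pow, Real.norm_eq_abs, sq_abs, Real.sq_sqrt ha, ENNReal.ofReal_mul ha]
  exact ENNReal.div_le_of_le_mul (mul_comm _ _).le

end Quotient

/-! ### Weak compactness in Hilbert spaces -/

/-- Bounded families in a Hilbert space converge weakly along every ultrafilter, and the pairing
with a strongly convergent family passes to the limit. -/
lemma exists_weak_limit {H ι : Type*} [NormedAddCommGroup H] [InnerProductSpace ℝ H]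
    [CompleteSpace H] (F : Ultrafilter ι) (ρ : ι → H) {R : ℝ} (hρ : ∀ᶠ i in F, ‖ρ i‖ ≤ R) :
    ∃ ρ' : H, ‖ρ'‖ ≤ R ∧ ∀ (w : ι → H) (w' : H), Tendsto w F (𝓝 w') →
      Tendsto (fun i => inner ℝ (ρ i) (w i)) F (𝓝 (inner ℝ ρ' w')) := by
  let T : ι → WeakDual ℝ H := fun i => StrongDual.toWeakDual (InnerProductSpace.toDual ℝ H (ρ i))
  have hT : (F.map T : Filter (WeakDual ℝ H)) ≤
      𝓟 (WeakDual.toStrongDual ⁻¹' Metric.closedBall (0 : StrongDual ℝ H) R) := by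
    rw [le_principal_iff, Ultrafilter.coe_map, mem_map]
    filter_upwards [hρ] with i hi
    simpa [T] using hi
  obtain ⟨ℓ, hℓ, hlim⟩ :=
    (WeakDual.isCompact_closedBall (0 : StrongDual ℝ H) R).ultrafilter_le_nhds (F.map T) hT
  refine ⟨(InnerProductSpace.toDual ℝ H).symm (WeakDual.toStrongDual ℓ), ?_, fun w w' hw => ?_⟩
  · simpa using hℓ
  -- split `⟪ρ i, w i⟫ = ⟪ρ i, w i - w'⟫ + ⟪ρ i, w'⟫`; boundedness of `ρ` kills the first term
  have hpt : Tendsto (fun i => inner ℝ (ρ i) w') F (𝓝 (ℓ w')) :=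
    ((WeakDual.eval_continuous w').tendsto ℓ).comp (f := T) hlim
  have hrest : Tendsto (fun i => inner ℝ (ρ i) (w i - w')) F (𝓝 0) := by
    have h0 : Tendsto (fun i => R * ‖w i - w'‖) F (𝓝 0) := by
      simpa using ((tendsto_iff_norm_sub_tendsto_zero.1 hw).const_mul R)
    refine squeeze_zero_norm' ?_ h0
    filter_upwards [hρ] with i hi
    exact (norm_inner_le_norm _ _).trans (by gcongr)
  rw [InnerProductSpace.toDual_symm_apply]
  simpa [inner_sub_right] using hrest.add hpt

/-! ### Estimates in Lebesgue spaces -/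

section Lebesgue

lemma abs_sqrt_sub_sqrt_le (a b : ℝ) : |Real.sqrt a - Real.sqrt b| ≤ Real.sqrt |a - b| := by
  wlog h : b ≤ a generalizing a b
  · rw [abs_sub_comm, abs_sub_comm a]
    exact this b a (le_of_not_ge h)
  rw [abs_of_nonneg (sub_nonneg.2 (Real.sqrt_le_sqrt h)), abs_of_nonneg (sub_nonneg.2 h),
    sub_le_iff_le_add]
  rcases le_total 0 b with hb | hb
  · refine Real.sqrt_le_iff.2 ⟨by positivity, ?_⟩
    rw [add_sq, Real.sq_sqrt (sub_nonneg.2 h), Real.sq_sqrt hb]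
    have : 0 ≤ 2 * Real.sqrt (a - b) * Real.sqrt b := by positivity
    linarith
  · rw [Real.sqrt_eq_zero_of_nonpos hb, add_zero]
    exact Real.sqrt_le_sqrt (by linarith)

variable {α : Type*} [MeasurableSpace α] {m : Measure α}

/-- The square root is Hölder continuous of exponent `1/2` from `L^s` to `L^{2s}`. -/
lemma eLpNorm_sqrt_sub_sqrt_le (s : ℝ≥0∞) (f g : α → ℝ) :
    eLpNorm (fun x => Real.sqrt (f x) - Real.sqrt (g x)) (2 * s) m
      ≤ eLpNorm (f - g) s m ^ (1 / 2 : ℝ) := by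
  have e : 2 * s * ENNReal.ofReal (1 / 2) = s := by
    rw [mul_comm 2 s, mul_assoc, one_div, ENNReal.ofReal_inv_of_pos two_pos, ENNReal.ofReal_ofNat,
      ENNReal.mul_inv_cancel two_ne_zero ENNReal.ofNat_ne_top, mul_one]
  have h := eLpNorm_norm_rpow (p := 2 * s) (μ := m) (f - g) (q := 1 / 2) (by norm_num)
  rw [e] at h
  rw [← h]
  refine eLpNorm_mono fun x => ?_
  rw [Real.norm_eq_abs, Real.norm_eq_abs, Pi.sub_apply, Real.norm_eq_abs, ← Real.sqrt_eq_rpow,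
    abs_of_nonneg (Real.sqrt_nonneg _)]
  exact abs_sqrt_sub_sqrt_le _ _

lemma memLp_sqrt {s : ℝ≥0∞} {f : α → ℝ} (hf : MemLp f s m) :
    MemLp (fun x => Real.sqrt (f x)) (2 * s) m := by
  refine ⟨Real.continuous_sqrt.comp_aestronglyMeasurable hf.1, ?_⟩
  have h := eLpNorm_sqrt_sub_sqrt_le (m := m) s f 0
  simp only [Pi.zero_apply, Real.sqrt_zero, sub_zero] at h
  exact h.trans_lt (ENNReal.rpow_lt_top_of_nonneg (by norm_num) hf.2.ne)

lemma eLpNorm_two_sq {E : Type*} [NormedAddCommGroup E] (g : α → E) :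
    eLpNorm g 2 m ^ 2 = ∫⁻ x, ENNReal.ofReal (‖g x‖ ^ 2) ∂m := by
  have h := eLpNorm_nnreal_pow_eq_lintegral (μ := m) (f := g) (p := 2) two_ne_zero
  simp only [NNReal.coe_ofNat, ENNReal.rpow_ofNat, ENNReal.coe_ofNat] at h
  rw [h]
  refine lintegral_congr fun x => ?_
  rw [← ofReal_norm, ENNReal.ofReal_pow (norm_nonneg _)]

lemma integrable_inner_of_memLp {E : Type*} [NormedAddCommGroup E] [InnerProductSpace ℝ E]
    {s q : ℝ≥0∞} [s.HolderTriple q 1] {f g : α → E} (hf : MemLp f s m) (hg : MemLp g q m) :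
    Integrable (fun x => inner ℝ (f x) (g x)) m := by
  refine (hf.norm.integrable_mul hg.norm).mono (hf.1.inner hg.1) (ae_of_all _ fun x => ?_)
  simpa using abs_real_inner_le_norm (f x) (g x)

variable {d : ℕ} {a b : α → ℝ} {e : α → Tensor d}

lemma aestronglyMeasurable_isotropic (ha : AEStronglyMeasurable a m)
    (hb : AEStronglyMeasurable b m) (he : AEStronglyMeasurable e m) :
    AEStronglyMeasurable (fun x => isotropic (a x) (b x) (e x)) m :=
  continuous_isotropic.comp_aestronglyMeasurable ((ha.prodMk hb).prodMk he)

lemma memLp_isotropic (hd : d ≠ 0) {s q t : ℝ≥0∞} [s.HolderTriple q t] (ha : MemLp a s m)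
    (hb : MemLp b s m) (he : MemLp e q m) :
    MemLp (fun x => isotropic (a x) (b x) (e x)) t m := by
  have h : MemLp ((fun x => ‖a x‖ + ‖b x‖) • e) t m := he.smul (ha.norm.add hb.norm)
  refine h.mono (aestronglyMeasurable_isotropic ha.1 hb.1 he.1) (ae_of_all _ fun x => ?_)
  refine (norm_isotropic_le hd _ _ _).trans_eq ?_
  rw [Pi.smul_apply', norm_smul, Real.norm_of_nonneg (by positivity), Real.norm_eq_abs,
    Real.norm_eq_abs]

lemma eLpNorm_isotropic_le (hd : d ≠ 0) {s q t : ℝ≥0∞} [s.HolderTriple q t] (hs : 1 ≤ s)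
    (ha : AEStronglyMeasurable a m) (hb : AEStronglyMeasurable b m)
    (he : AEStronglyMeasurable e m) :
    eLpNorm (fun x => isotropic (a x) (b x) (e x)) t m
      ≤ (eLpNorm a s m + eLpNorm b s m) * eLpNorm e q m := by
  have h1 : eLpNorm (fun x => isotropic (a x) (b x) (e x)) t m
      ≤ eLpNorm ((fun x => ‖a x‖ + ‖b x‖) • e) t m := by
    refine eLpNorm_mono fun x => (norm_isotropic_le hd _ _ _).trans_eq ?_
    rw [Pi.smul_apply', norm_smul, Real.norm_of_nonneg (by positivity), Real.norm_eq_abs,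
      Real.norm_eq_abs]
  refine h1.trans ((eLpNorm_smul_le_mul_eLpNorm (p := s) (q := q) he
    (ha.norm.add hb.norm)).trans ?_)
  gcongr
  refine (eLpNorm_add_le ha.norm hb.norm hs).trans_eq ?_
  rw [eLpNorm_norm, eLpNorm_norm]

end Lebesgue

/-! ### The exponents -/

section Exponents

lemma two_mul_expP (p : ℝ) : 2 * expP p = ENNReal.ofReal (2 * p) := by
  rw [expP, ENNReal.ofReal_mul zero_le_two, ENNReal.ofReal_ofNat]

variable (p : ℝ) [hp : Fact (1 < p)]

lemma one_le_two_mul_expP : 1 ≤ 2 * expP p := by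
  rw [two_mul_expP]
  exact ENNReal.one_le_ofReal.2 (by have := hp.out; linarith)

instance holderTriple_sqrtModulus_strain : (2 * expP p).HolderTriple (expR' p) 2 := by
  have h1 := hp.out
  have h2 : 0 < p - 1 := by linarith
  have h : (2 * p).HolderTriple (2 * p / (p - 1)) 2 :=
    ⟨by field_simp; ring, by positivity, by positivity⟩
  rw [two_mul_expP]
  simpa [expR'] using h.ennrealOfReal

instance holderTriple_sqrtModulus_two : (2 * expP p).HolderTriple 2 (expR p) := by
  have h1 := hp.out
  have h : (2 * p).HolderTriple 2 (2 * p / (p + 1)) :=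
    ⟨by field_simp; ring, by positivity, by positivity⟩
  rw [two_mul_expP]
  simpa [expR] using h.ennrealOfReal

instance holderTriple_stress_strain : (expR p).HolderTriple (expR' p) 1 := by
  have h1 := hp.out
  have h2 : 0 < p - 1 := by linarith
  have h : (2 * p / (p + 1)).HolderTriple (2 * p / (p - 1)) 1 :=
    ⟨by field_simp; ring, by positivity, by positivity⟩
  simpa [expR, expR'] using h.ennrealOfReal

end Exponents

variable {d : ℕ} {Ω Γ₀ : Set (Vec d)} {p : ℝ}

/-! ### Convexity of the compliance -/

/-- The energy density `(Tr σ)² / (d k) + ‖dev σ‖² / (2 μ)`. -/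
def energyDensity (k μ : ℝ) (σ : Tensor d) : ℝ≥0∞ :=
  ENNReal.ofReal (nTr σ ^ 2) / ENNReal.ofReal (d * k)
    + ENNReal.ofReal (‖dev σ‖ ^ 2) / ENNReal.ofReal (2 * μ)

lemma energyDensity_convexCombo_le {k μ k' μ' : ℝ} (hk : 0 ≤ k) (hμ : 0 ≤ μ) (hk' : 0 ≤ k')
    (hμ' : 0 ≤ μ') (σ σ' : Tensor d) {a b : ℝ} (ha : 0 < a) (hb : 0 < b) :
    energyDensity (a * k + b * k') (a * μ + b * μ') (a • σ + b • σ')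
      ≤ ENNReal.ofReal a * energyDensity k μ σ + ENNReal.ofReal b * energyDensity k' μ' σ' := by
  have h1 := ofReal_norm_convexCombo_sq_div_le (nTr σ) (nTr σ') (a := d * k) (b := d * k')
    (by positivity) (by positivity) ha hb
  have h2 := ofReal_norm_convexCombo_sq_div_le (dev σ) (dev σ') (a := 2 * μ) (b := 2 * μ')
    (by positivity) (by positivity) ha hb
  simp only [Real.norm_eq_abs, sq_abs, smul_eq_mul] at h1
  unfold energyDensity
  rw [nTr_add, nTr_smul, nTr_smul, dev_add, dev_smul, dev_smul,
    show (d : ℝ) * (a * k + b * k') = a * (d * k) + b * (d * k') by ring,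
    show 2 * (a * μ + b * μ') = a * (2 * μ) + b * (2 * μ') by ring]
  refine (add_le_add h1 h2).trans_eq ?_
  ring

lemma aemeasurable_energyDensity {m : Measure (Vec d)} {k μ : Vec d → ℝ} {τ : Vec d → Tensor d}
    (hk : AEMeasurable k m) (hμ : AEMeasurable μ m) (hτ : AEStronglyMeasurable τ m) :
    AEMeasurable (fun x => energyDensity (k x) (μ x) (τ x)) m := by
  have h1 : AEMeasurable (fun x => nTr (τ x)) m :=
    (continuous_nTr.comp_aestronglyMeasurable hτ).aemeasurable
  have h2 : AEMeasurable (fun x => ‖dev (τ x)‖) m :=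
    (continuous_dev.comp_aestronglyMeasurable hτ).norm.aemeasurable
  unfold energyDensity
  fun_prop

lemma convex_nonnegModuli : Convex ℝ≥0 (nonnegModuli Ω p) := by
  rintro z ⟨h1, h2⟩ z' ⟨h3, h4⟩ a b - - -
  have hs : ∀ (c : ℝ≥0) (u : Lp ℝ (expP p) (volume.restrict Ω)), 0 ≤ u → 0 ≤ c • u := by
    intro c u hu
    rw [← Lp.coeFn_nonneg] at hu ⊢
    filter_upwards [hu, Lp.coeFn_smul (c : ℝ) u] with x hx hc
    rw [NNReal.smul_def, hc, Pi.smul_apply, smul_eq_mul]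
    exact mul_nonneg c.2 hx
  exact ⟨add_nonneg (hs a _ h1) (hs b _ h3), add_nonneg (hs a _ h2) (hs b _ h4)⟩

lemma stressEnergy_convexCombo_le {z z' : Moduli Ω p} (hz : z ∈ nonnegModuli Ω p)
    (hz' : z' ∈ nonnegModuli Ω p) (τ τ' : Lp (Tensor d) (expR p) (volume.restrict Ω)) {a b : ℝ}
    (ha : 0 < a) (hb : 0 < b) :
    stressEnergy Ω (a • z + b • z').1 (a • z + b • z').2
        (a • τ + b • τ' : Lp (Tensor d) (expR p) (volume.restrict Ω))
      ≤ ENNReal.ofReal a * stressEnergy Ω z.1 z.2 τ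
        + ENNReal.ofReal b * stressEnergy Ω z'.1 z'.2 τ' := by
  have hae : ∀ {E : Type} [NormedAddCommGroup E] [NormedSpace ℝ E] {s : ℝ≥0∞}
      (u u' : Lp E s (volume.restrict Ω)),
      ∀ᵐ x ∂(volume.restrict Ω), (a • u + b • u') x = a • u x + b • u' x := by
    intro E _ _ s u u'
    filter_upwards [Lp.coeFn_add (a • u) (b • u'), Lp.coeFn_smul a u, Lp.coeFn_smul b u']
      with x h1 h2 h3
    rw [h1, Pi.add_apply, h2, h3, Pi.smul_apply, Pi.smul_apply]
  have hm := aemeasurable_energyDensity (Lp.aestronglyMeasurable z.1).aemeasurable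
    (Lp.aestronglyMeasurable z.2).aemeasurable (Lp.aestronglyMeasurable τ)
  have hm' := aemeasurable_energyDensity (Lp.aestronglyMeasurable z'.1).aemeasurable
    (Lp.aestronglyMeasurable z'.2).aemeasurable (Lp.aestronglyMeasurable τ')
  change (∫⁻ x in Ω, energyDensity _ _ _) ≤ ENNReal.ofReal a * (∫⁻ x in Ω, energyDensity _ _ _)
    + ENNReal.ofReal b * ∫⁻ x in Ω, energyDensity _ _ _
  rw [← lintegral_const_mul'' _ hm, ← lintegral_const_mul'' _ hm',
    ← lintegral_add_left' (hm.const_mul _)]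
  refine lintegral_mono_ae ?_
  filter_upwards [hae z.1 z'.1, hae z.2 z'.2, hae τ τ', Lp.coeFn_nonneg z.1 |>.2 hz.1,
    Lp.coeFn_nonneg z.2 |>.2 hz.2, Lp.coeFn_nonneg z'.1 |>.2 hz'.1,
    Lp.coeFn_nonneg z'.2 |>.2 hz'.2] with x h1 h2 h3 h4 h5 h6 h7
  rw [Prod.fst_add, Prod.snd_add, Prod.smul_fst, Prod.smul_fst, Prod.smul_snd, Prod.smul_snd, h1,
    h2, h3]
  exact energyDensity_convexCombo_le h4 h5 h6 h7 _ _ ha hb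

variable [Fact (1 < p)]

lemma memLp_strain {s : ℝ≥0∞} [Fact (1 ≤ s)] (v : Sobolev Ω s) :
    MemLp (strain v) s (volume.restrict Ω) := by
  refine (Lp.memLp v.1.2).mono ?_ (ae_of_all _ fun x => norm_symPart_le _)
  exact continuous_symPart.comp_aestronglyMeasurable (Lp.aestronglyMeasurable _)

lemma admissibleStresses_convexCombo {f : Load Ω p}
    {τ τ' : Lp (Tensor d) (expR p) (volume.restrict Ω)} (hτ : τ ∈ admissibleStresses Ω Γ₀ p f)
    (hτ' : τ' ∈ admissibleStresses Ω Γ₀ p f) {a b : ℝ} (hab : a + b = 1) :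
    a • τ + b • τ' ∈ admissibleStresses Ω Γ₀ p f := by
  have hae : ∀ᵐ x ∂(volume.restrict Ω), (a • τ + b • τ') x = a • τ x + b • τ' x := by
    filter_upwards [Lp.coeFn_add (a • τ) (b • τ'), Lp.coeFn_smul a τ, Lp.coeFn_smul b τ']
      with x h1 h2 h3
    rw [h1, Pi.add_apply, h2, h3, Pi.smul_apply, Pi.smul_apply]
  refine ⟨?_, fun v hv => ?_⟩
  · filter_upwards [hae, hτ.1, hτ'.1] with x hx h1 h2
    rw [hx]
    exact (h1.smul a).add (h2.smul b)
  · have e : ∫ x in Ω, inner ℝ ((a • τ + b • τ') x) (strain v x)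
        = ∫ x in Ω, (a * inner ℝ (τ x) (strain v x) + b * inner ℝ (τ' x) (strain v x)) := by
      refine integral_congr_ae ?_
      filter_upwards [hae] with x hx
      rw [hx, inner_add_left, real_inner_smul_left, real_inner_smul_left]
    have hi : ∀ σ : Lp (Tensor d) (expR p) (volume.restrict Ω),
        Integrable (fun x => inner ℝ (σ x) (strain v x)) (volume.restrict Ω) := fun σ =>
      integrable_inner_of_memLp (Lp.memLp σ) (memLp_strain v)
    rw [e, integral_add ((hi τ).const_mul a) ((hi τ').const_mul b), integral_const_mul,
      integral_const_mul, hτ.2 v hv, hτ'.2 v hv, ← add_mul, hab, one_mul]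

theorem convexOn_compliance (f : Load Ω p) :
    ConvexOn ℝ≥0 (nonnegModuli Ω p) (compliance Ω Γ₀ p f) := by
  refine ⟨convex_nonnegModuli, fun z hz z' hz' a b _ _ hab => ?_⟩
  -- zero weights are treated apart because `0 * ∞ = 0` does not commute with infima
  rcases eq_or_ne a 0 with rfl | ha
  · rw [zero_add] at hab
    simp [hab]
  rcases eq_or_ne b 0 with rfl | hb
  · rw [add_zero] at hab
    simp [hab]
  have ha' : (0 : ℝ) < a := NNReal.coe_pos.2 (pos_iff_ne_zero.2 ha)
  have hb' : (0 : ℝ) < b := NNReal.coe_pos.2 (pos_iff_ne_zero.2 hb)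
  have hab' : (a : ℝ) + b = 1 := by exact_mod_cast hab
  simp only [ENNReal.smul_def, smul_eq_mul, compliance]
  simp only [ENNReal.mul_iInf_of_ne (ENNReal.coe_ne_zero.2 ha) ENNReal.coe_ne_top,
    ENNReal.mul_iInf_of_ne (ENNReal.coe_ne_zero.2 hb) ENNReal.coe_ne_top, ENNReal.iInf_add,
    ENNReal.add_iInf]
  refine le_iInf₂ fun τ' hτ' => le_iInf₂ fun τ hτ => ?_
  refine (iInf₂_le ((a : ℝ) • τ + (b : ℝ) • τ')
    (admissibleStresses_convexCombo hτ hτ' hab')).trans ?_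
  have h := stressEnergy_convexCombo_le hz hz' τ τ' ha' hb'
  rwa [ENNReal.ofReal_coe_nnreal, ENNReal.ofReal_coe_nnreal] at h

/-! ### Stresses of finite energy and square integrable fields -/

/-- For `z = (k, μ)`, the field `√(d k) (tr e / d) I + √(2 μ) dev e`, which belongs to `L²` when `e`
belongs to `L^{r'}`. -/
def weightedField (hd : d ≠ 0) (z : Moduli Ω p) {e : Vec d → Tensor d}
    (he : MemLp e (expR' p) (volume.restrict Ω)) : Lp (Tensor d) 2 (volume.restrict Ω) :=
  (memLp_isotropic hd (memLp_sqrt ((Lp.memLp z.1).const_mul (d : ℝ)))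
    (memLp_sqrt ((Lp.memLp z.2).const_mul 2)) he).toLp _

lemma coeFn_weightedField (hd : d ≠ 0) (z : Moduli Ω p) {e : Vec d → Tensor d}
    (he : MemLp e (expR' p) (volume.restrict Ω)) :
    ∀ᵐ x ∂(volume.restrict Ω), weightedField hd z he x
      = isotropic (Real.sqrt (d * z.1 x)) (Real.sqrt (2 * z.2 x)) (e x) :=
  MemLp.coeFn_toLp _

/-- The weights `√(d k)`, `√(2 μ)` depend continuously in `L^{2p}` on `(k, μ)` in `L^p`, and
`1/(2p) + 1/r' = 1/2`. -/
lemma continuous_weightedField (hd : d ≠ 0) {e : Vec d → Tensor d}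
    (he : MemLp e (expR' p) (volume.restrict Ω)) :
    Continuous fun z : Moduli Ω p => weightedField hd z he := by
  refine continuous_iff_continuousAt.2 fun z₀ => ?_
  refine (Lp.tendsto_Lp_iff_tendsto_eLpNorm'' _ _ _ _).2 ?_
  have hsqrt : ∀ (c : ℝ) (u : Moduli Ω p → Lp ℝ (expP p) (volume.restrict Ω)), Continuous u →
      Tendsto (fun z => eLpNorm (fun x => Real.sqrt (c * u z x) - Real.sqrt (c * u z₀ x))
        (2 * expP p) (volume.restrict Ω)) (𝓝 z₀) (𝓝 0) := by
    intro c u hu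
    have h1 := (Lp.tendsto_Lp_iff_tendsto_eLpNorm' _ _).1 (hu.tendsto z₀)
    have h2 : Tendsto (fun z => (‖c‖ₑ * eLpNorm (⇑(u z) - ⇑(u z₀)) (expP p) (volume.restrict Ω))
        ^ (1 / 2 : ℝ)) (𝓝 z₀) (𝓝 0) := by
      have h3 := (ENNReal.Tendsto.const_mul h1 (Or.inr (enorm_ne_top (x := c)))).ennrpow_const
        (1 / 2 : ℝ)
      simpa using h3
    refine tendsto_of_tendsto_of_tendsto_of_le_of_le tendsto_const_nhds h2 (fun _ => zero_le)
      fun z => ?_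
    refine (eLpNorm_sqrt_sub_sqrt_le (expP p) _ _).trans_eq ?_
    rw [← eLpNorm_const_smul]
    congr 2
    ext x
    simp [mul_sub]
  have h := ENNReal.Tendsto.mul_const ((hsqrt d Prod.fst continuous_fst).add
    (hsqrt 2 Prod.snd continuous_snd)) (b := eLpNorm e (expR' p) (volume.restrict Ω))
    (Or.inr he.2.ne)
  rw [add_zero, zero_mul] at h
  refine tendsto_of_tendsto_of_tendsto_of_le_of_le tendsto_const_nhds h (fun _ => zero_le)
    fun z => ?_
  have hm : ∀ (c : ℝ) (u : Lp ℝ (expP p) (volume.restrict Ω)),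
      AEStronglyMeasurable (fun x => Real.sqrt (c * u x)) (volume.restrict Ω) := fun c u =>
    (memLp_sqrt ((Lp.memLp u).const_mul c)).1
  refine le_trans (le_of_eq ?_) (eLpNorm_isotropic_le hd (t := 2) (one_le_two_mul_expP p)
    ((hm d z.1).sub (hm d z₀.1)) ((hm 2 z.2).sub (hm 2 z₀.2)) he.1)
  congr 1
  ext1 x
  exact isotropic_sub_isotropic _ _ _ _ _

lemma inner_weightedField (hd : d ≠ 0) (z : Moduli Ω p) {e : Vec d → Tensor d}
    (he : MemLp e (expR' p) (volume.restrict Ω)) (ρ : Lp (Tensor d) 2 (volume.restrict Ω)) :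
    inner ℝ ρ (weightedField hd z he) = ∫ x in Ω,
      inner ℝ (isotropic (Real.sqrt (d * z.1 x)) (Real.sqrt (2 * z.2 x)) (ρ x)) (e x) := by
  rw [L2.inner_def]
  refine integral_congr_ae ?_
  filter_upwards [coeFn_weightedField hd z he] with x hx
  rw [hx, inner_isotropic_comm hd]

/-- An admissible stress `τ` of finite energy is of the form
`√(d k) (tr ρ / d) I + √(2 μ) dev ρ`, where the square of the norm of `ρ` in `L²` is the energy
of `τ`. -/
lemma exists_inner_weightedField_eq (hd : d ≠ 0) {f : Load Ω p} {z : Moduli Ω p}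
    (hz : z ∈ nonnegModuli Ω p) {τ : Lp (Tensor d) (expR p) (volume.restrict Ω)}
    (hτ : τ ∈ admissibleStresses Ω Γ₀ p f) (hE : stressEnergy Ω z.1 z.2 τ ≠ ⊤) :
    ∃ ρ : Lp (Tensor d) 2 (volume.restrict Ω), ‖ρ‖ₑ ^ 2 = stressEnergy Ω z.1 z.2 τ ∧
      ∀ v ∈ virtualDisplacements Ω Γ₀ (expR' p),
        inner ℝ ρ (weightedField hd z (memLp_strain v)) = f v := by
  have hk := (Lp.aestronglyMeasurable z.1).aemeasurable
  have hμ := (Lp.aestronglyMeasurable z.2).aemeasurable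
  have hm := aemeasurable_energyDensity hk hμ (Lp.aestronglyMeasurable τ)
  -- where a modulus vanishes, its inverse is `0`, and so is the corresponding part of `τ`
  let g : Vec d → Tensor d := fun x =>
    isotropic (Real.sqrt (d * z.1 x))⁻¹ (Real.sqrt (2 * z.2 x))⁻¹ (τ x)
  have hg : AEStronglyMeasurable g (volume.restrict Ω) :=
    aestronglyMeasurable_isotropic (AEMeasurable.aestronglyMeasurable (by fun_prop))
      (AEMeasurable.aestronglyMeasurable (by fun_prop)) (Lp.aestronglyMeasurable τ)
  have hpt : ∀ᵐ x ∂(volume.restrict Ω),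
      ENNReal.ofReal (‖g x‖ ^ 2) = energyDensity (z.1 x) (z.2 x) (τ x) ∧
      isotropic (Real.sqrt (d * z.1 x)) (Real.sqrt (2 * z.2 x)) (g x) = τ x := by
    filter_upwards [ae_lt_top' hm hE, Lp.coeFn_nonneg z.1 |>.2 hz.1,
      Lp.coeFn_nonneg z.2 |>.2 hz.2] with x hx h1 h2
    rw [Pi.zero_apply] at h1 h2
    obtain ⟨hx1, hx2⟩ := ENNReal.add_ne_top.1 hx.ne
    have hx1' : ENNReal.ofReal (‖nTr (τ x)‖ ^ 2) / ENNReal.ofReal (d * z.1 x) ≠ ⊤ := by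
      simpa using hx1
    obtain ⟨e1, c1⟩ := ofReal_norm_sq_div_eq (nTr (τ x)) (mul_nonneg d.cast_nonneg h1) hx1'
    obtain ⟨e2, c2⟩ := ofReal_norm_sq_div_eq (dev (τ x)) (mul_nonneg zero_le_two h2) hx2
    rw [Real.norm_eq_abs, sq_abs] at e1
    refine ⟨?_, ?_⟩
    · rw [norm_isotropic_sq hd, energyDensity, e1, e2,
        ENNReal.ofReal_add (by positivity) (by positivity)]
    · rw [isotropic_isotropic hd]
      exact isotropic_eq_self hd c1 c2
  have hint : eLpNorm g 2 (volume.restrict Ω) ^ 2 = stressEnergy Ω z.1 z.2 τ := by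
    rw [eLpNorm_two_sq]
    exact lintegral_congr_ae (hpt.mono fun x hx => hx.1)
  have hg2 : MemLp g 2 (volume.restrict Ω) := by
    refine ⟨hg, lt_top_iff_ne_top.2 fun h => hE ?_⟩
    rw [← hint, h]
    rfl
  refine ⟨hg2.toLp g, by rw [Lp.enorm_toLp, hint], fun v hv => ?_⟩
  rw [inner_weightedField, ← hτ.2 v hv]
  refine integral_congr_ae ?_
  filter_upwards [hpt, hg2.coeFn_toLp] with x hx hgx
  rw [hgx, hx.2]

/-- Conversely, a field `ρ` in `L²` gives an admissible stress
`√(d k) (tr ρ / d) I + √(2 μ) dev ρ`, up to symmetrization; it belongs to `L^r` because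
`1/(2p) + 1/2 = 1/r`. -/
lemma compliance_le_of_inner_weightedField_eq (hd : d ≠ 0) {f : Load Ω p} {z : Moduli Ω p}
    (hz : z ∈ nonnegModuli Ω p) (ρ : Lp (Tensor d) 2 (volume.restrict Ω))
    (hρ : ∀ v ∈ virtualDisplacements Ω Γ₀ (expR' p),
      inner ℝ ρ (weightedField hd z (memLp_strain v)) = f v) :
    compliance Ω Γ₀ p f z ≤ ‖ρ‖ₑ ^ 2 := by
  let g : Vec d → Tensor d := fun x =>
    isotropic (Real.sqrt (d * z.1 x)) (Real.sqrt (2 * z.2 x)) (ρ x)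
  have hg : MemLp g (expR p) (volume.restrict Ω) :=
    memLp_isotropic hd (memLp_sqrt ((Lp.memLp z.1).const_mul (d : ℝ)))
      (memLp_sqrt ((Lp.memLp z.2).const_mul 2)) (Lp.memLp ρ)
  have hg' : MemLp (fun x => symPart (g x)) (expR p) (volume.restrict Ω) :=
    hg.mono (continuous_symPart.comp_aestronglyMeasurable hg.1)
      (ae_of_all _ fun x => norm_symPart_le _)
  have hτ : hg'.toLp _ ∈ admissibleStresses Ω Γ₀ p f := by
    refine ⟨?_, fun v hv => ?_⟩
    · filter_upwards [hg'.coeFn_toLp] with x hx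
      rw [hx]
      exact isSymmetric_symPart _
    · rw [← hρ v hv, inner_weightedField]
      refine integral_congr_ae ?_
      filter_upwards [hg'.coeFn_toLp] with x hx
      rw [hx, inner_symPart_comm, strain, symPart_symPart]
  refine (iInf₂_le _ hτ).trans ?_
  rw [Lp.enorm_def, eLpNorm_two_sq]
  refine lintegral_mono_ae ?_
  filter_upwards [hg'.coeFn_toLp, Lp.coeFn_nonneg z.1 |>.2 hz.1,
    Lp.coeFn_nonneg z.2 |>.2 hz.2] with x hx h1 h2
  rw [Pi.zero_apply] at h1 h2
  have e1 := ofReal_norm_sqrt_smul_sq_div_le (nTr (ρ x)) (mul_nonneg d.cast_nonneg h1)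
  have e2 := ofReal_norm_sqrt_smul_sq_div_le (dev (ρ x)) (mul_nonneg zero_le_two h2)
  rw [Real.norm_eq_abs, sq_abs, smul_eq_mul, Real.norm_eq_abs, sq_abs] at e1
  have e3 : nTr (symPart (g x)) = Real.sqrt (d * z.1 x) * nTr (ρ x) := by
    rw [nTr, tr_symPart, ← nTr, nTr_isotropic hd]
  have e4 : ‖dev (symPart (g x))‖ ≤ ‖Real.sqrt (2 * z.2 x) • dev (ρ x)‖ := by
    rw [dev_symPart, ← dev_isotropic hd]
    exact norm_symPart_le _
  rw [hx, e3, norm_sq_eq_nTr_sq_add hd (ρ x),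
    ENNReal.ofReal_add (sq_nonneg _) (sq_nonneg _)]
  refine add_le_add e1 (le_trans ?_ e2)
  gcongr

/-! ### Lower semicontinuity of the compliance -/

lemma isClosed_nonnegModuli : IsClosed (nonnegModuli Ω p) := by
  have h : IsClosed {u : Lp ℝ (expP p) (volume.restrict Ω) | 0 ≤ u} :=
    isClosed_le continuous_const continuous_id
  exact (h.preimage continuous_fst).inter (h.preimage continuous_snd)

/-- The sublevel sets of the compliance are closed for the norm topology: along an ultrafilter
converging to `z`, the fields `ρ` attached to almost optimal stresses converge weakly in `L²`,
while the weighted strains converge strongly. -/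
lemma isClosed_sublevel_compliance (hd : d ≠ 0) (f : Load Ω p) (t : ℝ≥0∞) :
    IsClosed {z ∈ nonnegModuli Ω p | compliance Ω Γ₀ p f z ≤ t} := by
  refine isClosed_of_closure_subset fun z hz => ?_
  have hz0 : z ∈ nonnegModuli Ω p :=
    closure_minimal (fun _ h => h.1) isClosed_nonnegModuli hz
  refine ⟨hz0, ?_⟩
  obtain ⟨F, hF, hFz⟩ := mem_closure_iff_ultrafilter.1 hz
  refine le_of_forall_gt_imp_ge_of_dense fun t' ht' => ?_
  rcases eq_or_ne t' ⊤ with rfl | ht'top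
  · exact le_top
  have hex : ∀ y : Moduli Ω p, ∃ ρ : Lp (Tensor d) 2 (volume.restrict Ω),
      y ∈ {z ∈ nonnegModuli Ω p | compliance Ω Γ₀ p f z ≤ t} → ‖ρ‖ₑ ^ 2 ≤ t' ∧
        ∀ v ∈ virtualDisplacements Ω Γ₀ (expR' p),
          inner ℝ ρ (weightedField hd y (memLp_strain v)) = f v := by
    intro y
    by_cases hy : y ∈ {z ∈ nonnegModuli Ω p | compliance Ω Γ₀ p f z ≤ t}
    · obtain ⟨τ, hlt⟩ := iInf_lt_iff.1 (hy.2.trans_lt ht')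
      obtain ⟨hτ, hlt⟩ := iInf_lt_iff.1 hlt
      obtain ⟨ρ, h1, h2⟩ := exists_inner_weightedField_eq hd hy.1 hτ (hlt.trans_le le_top).ne
      exact ⟨ρ, fun _ => ⟨h1.trans_le hlt.le, h2⟩⟩
    · exact ⟨0, fun h => absurd h hy⟩
  choose ρ hρ using hex
  have hsq : ∀ u : Lp (Tensor d) 2 (volume.restrict Ω),
      ‖u‖ₑ ^ 2 ≤ t' ↔ ‖u‖ ≤ Real.sqrt t'.toReal := by
    intro u
    rw [Real.le_sqrt (norm_nonneg u) ENNReal.toReal_nonneg, ← ofReal_norm,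
      ← ENNReal.ofReal_pow (norm_nonneg u), ENNReal.ofReal_le_iff_le_toReal ht'top]
  obtain ⟨ρ', hρ', hlim⟩ := exists_weak_limit F ρ (R := Real.sqrt t'.toReal) <| by
    filter_upwards [hF] with y hy
    exact (hsq _).1 (hρ y hy).1
  refine (compliance_le_of_inner_weightedField_eq hd hz0 ρ' fun v hv => ?_).trans ((hsq _).2 hρ')
  have h1 := hlim _ _ (((continuous_weightedField hd (memLp_strain v)).tendsto z).mono_left hFz)
  refine tendsto_nhds_unique h1 (tendsto_const_nhds.congr' ?_)
  filter_upwards [hF] with y hy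
  exact ((hρ y hy).2 v hv).symm

lemma convex_sublevel_compliance (f : Load Ω p) (t : ℝ≥0∞) :
    Convex ℝ {z ∈ nonnegModuli Ω p | compliance Ω Γ₀ p f z ≤ t} := by
  intro x hx y hy a b ha hb hab
  exact (convexOn_compliance f).convex_le t hx hy (a := ⟨a, ha⟩) (b := ⟨b, hb⟩) zero_le zero_le
    (NNReal.eq hab)

/-- The sublevel sets are convex and closed for the norm topology, hence weakly closed. -/
theorem lowerSemicontinuousOn_compliance_weakSpace (hd : d ≠ 0) (f : Load Ω p) :
    LowerSemicontinuousOn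
      (fun z : WeakSpace ℝ (Moduli Ω p) =>
        compliance Ω Γ₀ p f ((toWeakSpace ℝ (Moduli Ω p)).symm z))
      (toWeakSpace ℝ (Moduli Ω p) '' nonnegModuli Ω p) := by
  intro z _ t ht
  have hcl : IsClosed (toWeakSpace ℝ (Moduli Ω p) ''
      {z ∈ nonnegModuli Ω p | compliance Ω Γ₀ p f z ≤ t}) := by
    rw [← closure_eq_iff_isClosed,
      ← (convex_sublevel_compliance f t).toWeakSpace_closure ℝ,
      (isClosed_sublevel_compliance hd f t).closure_eq]
  have hz : z ∉ toWeakSpace ℝ (Moduli Ω p) ''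
      {z ∈ nonnegModuli Ω p | compliance Ω Γ₀ p f z ≤ t} := by
    rintro ⟨y, hy, rfl⟩
    refine absurd ht (not_lt.2 ?_)
    simpa using hy.2
  filter_upwards [nhdsWithin_le_nhds (hcl.isOpen_compl.mem_nhds hz), self_mem_nhdsWithin]
  rintro _ hy ⟨y, hy0, rfl⟩
  refine lt_of_not_ge fun hle => hy ⟨y, ⟨hy0, ?_⟩, rfl⟩
  simpa using hle

end Elasticity

end

theorem mainTheorem10 (d : ℕ) (hd : 1 ≤ d) (Ω Γ₀ : Set (Elasticity.Vec d))
    (hΩo : IsOpen Ω) (hΩb : Bornology.IsBounded Ω) (hΩl : Elasticity.HasLipschitzBoundary Ω)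
    (hΓ : Γ₀ ⊆ frontier Ω) (hΓpos : 0 < Elasticity.surfaceMeasure Ω Γ₀)
    (p : ℝ) [Fact (1 < p)] (f : Elasticity.Load Ω p) :
    ConvexOn ℝ≥0 (Elasticity.nonnegModuli Ω p) (Elasticity.compliance Ω Γ₀ p f) ∧
      LowerSemicontinuousOn
        (fun z : WeakSpace ℝ (Elasticity.Moduli Ω p) =>
          Elasticity.compliance Ω Γ₀ p f ((toWeakSpace ℝ (Elasticity.Moduli Ω p)).symm z))
        (toWeakSpace ℝ (Elasticity.Moduli Ω p) '' Elasticity.nonnegModuli Ω p) := by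
  have hd' : d ≠ 0 := Nat.one_le_iff_ne_zero.1 hd
  exact ⟨Elasticity.convexOn_compliance f,
    Elasticity.lowerSemicontinuousOn_compliance_weakSpace hd' f⟩
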